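/- **Conventions.** For a set $X$, let $X^*$ be the free monoid of all words over $X$, with empty word $\iota$. For a set $R\subseteq X^*\times X^*$ let $R^\sharp$ be the congruence on $X^*$ generated by $R$. A monoid $N$ has presentation $\langle X\mid R\rangle$ via $\phi:X^*\to N$ if $\phi$ is a surjective monoid homomorphism with kernel $\{(u,v): u\phi=v\phi\}=R^\sharp$. An element $(u,v)$ of $R$ is written as an equation $u=v$. **The wreath product.** Let $n\ge 0$, let $\mathbf n=\{1,\dots,n\}$, and let $\mathcal I_n$ be the symmetric inverse monoid of all injective partial maps $\mathbf n\to\mathbf n$, which are composed from left to right. Let $M$ be a monoid, and let $M_0=M\cup\{0\}$ be the monoid obtained by adjoining a new zero element. For $\mathbf a=(a_1,\dots,a_n)\in M_0^n$ put $\operatorname{supp}(\mathbf a)=\{i: a_i\ne 0\}$. For $\alpha\in\mathcal I_n$ let ${}^\alpha\mathbf a\in M_0^n$ be the tuple with $i$th entry $a_{i\alpha}$ if $i\in\operatorname{dom}(\alpha)$ and $0$ otherwise. The wreath product is the monoid $$M\wr\mathcal I_n=\{(\mathbf a,\alpha)\in M_0^n\times\mathcal I_n:\operatorname{supp}(\mathbf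 a)=\operatorname{dom}(\alpha)\},\qquad (\mathbf a,\alpha)(\mathbf b,\beta)=(\mathbf a\cdot{}^\alpha\mathbf b,\ \alpha\beta).$$ Identify $\alpha\in\mathcal I_n$ with $(\mathbf 1_{\operatorname{dom}(\alpha)},\alpha)$, where $\mathbf 1_A$ is the $0$-$1$-tuple with support $A$, and identify $\mathbf a\in M^n$ with $(\mathbf a,\mathrm{id})$. **Generators.** Suppose that $M$ has presentation $\langle X_M\mid R_M\rangle$ via $\phi_M$. Let $X^{(i)}=\{x^{(i)}:x\in X_M\}$ for $i\in\mathbf n$ be pairwise disjoint copies of $X_M$, and let $$X_{M\wr\mathcal I_n}=\{s_1,\dots,s_{n-1}\}\cup\{e_1,\dots,e_n\}\cup X^{(1)}\cup\dots\cup X^{(n)}$$ (a disjoint union). For a word $w=x_1\cdots x_k$ over $X_M$ put $w^{(i)}=x_1^{(i)}\cdots x_k^{(i)}$. Let $\phi:X_{M\wr\mathcal I_n}^*\to M\wr\mathcal I_n$ be the homomorphism which sends $s_i$ to the transposition $(i,i+1)$, sends $e_i$ to the partial identity with domain $\mathbf n\setminus\{i\}$, and sends $x^{(i)}$ to the tuple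 $(1,\dots,1,x\phi_M,1,\dots,1)\in M^n$ with $x\phi_M$ in position $i$. **Relations.** Let $R_{M\wr\mathcal I_n}$ be the following set of relations, where the indices $i,j$ range over all meaningful values and $x,y$ over $X_M$, subject to the stated constraints: - (In1) $s_i^2=\iota$; - (In2) $s_is_j=s_js_i$ if $|i-j|>1$; - (In3) $s_is_js_i=s_js_is_j$ if $|i-j|=1$; - (In4) $e_i^2=e_i$; - (In5) $e_ie_j=e_je_i$; - (In6) $s_ie_j=e_js_i$ if $j\ne i,i+1$; - (In7) $s_ie_i=e_{i+1}s_i$; - (In8) $e_ie_{i+1}s_i=e_ie_{i+1}$; - (MIn1) $u^{(i)}=v^{(i)}$ for all $(u,v)\in R_M$ and $i\in\mathbf n$; - (MIn2) $x^{(i)}y^{(j)}=y^{(j)}x^{(i)}$ if $i\ne j$; - (MIn3) $s_ix^{(j)}=x^{(j)}s_i$ if $j\ne i,i+1$; - (MIn4) $s_ix^{(i)}=x^{(i+1)}s_i$; - (MIn5) $e_ix^{(j)}=x^{(j)}e_i$ if $i\ne j$; - (MIn6) $e_ix^{(i)}=e_i=x^{(i)}e_i$. **Theorem.** For every monoid $M$,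 every presentation $\langle X_M\mid R_M\rangle$ of $M$ via a homomorphism $\phi_M$, and every $n\ge 0$, the wreath product $M\wr\mathcal I_n$ has presentation $\langle X_{M\wr\mathcal I_n}\mid R_{M\wr\mathcal I_n}\rangle$ via $\phi$. -/

import Mathlib

universe u v

/-- The monoid `M` has presentation `⟨X | R⟩` via `φ : X* → M`: the morphism `φ` is surjective and
its kernel is the congruence `R♯` on `X*` generated by the set of relations `R`. -/
def HasMonoidPresentation {X : Type u} {M : Type v} [Monoid M]
    (R : FreeMonoid X → FreeMonoid X → Prop) (φ : FreeMonoid X →* M) : Prop :=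
  Function.Surjective φ ∧ Con.ker φ = conGen R

/-- The underlying set of the symmetric inverse monoid `I_n`: all partial permutations of an
`n`-element set. The product of `α` and `β` is `α.trans β` (first `α`, then `β`). -/
abbrev SymInv (n : ℕ) : Type := Fin n ≃. Fin n

namespace SymInv

/-- The domain of a partial permutation. -/
def dom {n : ℕ} (α : SymInv n) : Set (Fin n) := {i | ∃ j, j ∈ α i}

/-- The transposition of two points. -/
def transposition {n : ℕ} (i j : Fin n) : SymInv n := (Equiv.swap i j).toPEquiv

/-- The partial identity whose domain omits exactly the point `i`. -/
def omitPoint {n : ℕ} (i : Fin n) : SymInv n := PEquiv.ofSet {j | j ≠ i}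

/-- The tuple `^α a` with entry `a_{iα}` at each `i ∈ dom α`, and `0` at all other `i`. Here
`WithZero M` is the monoid `M` with a new zero adjoined. -/
def act {M : Type v} {n : ℕ} (α : SymInv n) (a : Fin n → WithZero M) : Fin n → WithZero M :=
  fun i => (α i).elim 0 a

end SymInv

/-- The wreath product `M ≀ I_n`: pairs `(a, α)` of a tuple `a` over `M ∪ {0}` and a partial
permutation `α` such that `supp a = dom α`. -/
@[ext]
structure WreathSymInv (M : Type v) [Monoid M] (n : ℕ) where
  tuple : Fin n → WithZero M
  map : SymInv n
  supp_eq_dom : Function.support tuple = map.dom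

namespace WreathSymInv

variable {M : Type v} [Monoid M] {n : ℕ}

/-- The product `(a, α) (b, β) = (a · ^α b, α β)`. -/
instance : Mul (WreathSymInv M n) where
  mul p q :=
    { tuple := p.tuple * p.map.act q.tuple
      map := p.map.trans q.map
      supp_eq_dom := by
        ext i
        have hp := Set.ext_iff.1 p.supp_eq_dom i
        simp only [SymInv.dom, Function.mem_support, Set.mem_ofPred_eq] at hp
        rcases h : p.map i with _ | j
        · have ht : (p.map.trans q.map) i = none := by
            change (p.map i).bind q.map = none
            rw [h]
            rfl
          simp [SymInv.dom, SymInv.act, h, ht]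
        · have hq := Set.ext_iff.1 q.supp_eq_dom j
          simp only [SymInv.dom, Function.mem_support, Set.mem_ofPred_eq] at hq
          have hi : p.tuple i ≠ 0 := hp.2 ⟨j, h⟩
          have ht : (p.map.trans q.map) i = q.map j := by
            change (p.map i).bind q.map = q.map j
            rw [h]
            rfl
          simp [SymInv.dom, SymInv.act, h, hi, hq, ht] }

/-- The identity `((1, …, 1), id)`. -/
instance : One (WreathSymInv M n) where
  one :=
    { tuple := 1
      map := PEquiv.refl (Fin n)
      supp_eq_dom := by
        ext i
        simp [SymInv.dom] }

theorem mul_tuple (p q : WreathSymInv M n) : (p * q).tuple = p.tuple * p.map.act q.tuple := rfl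

theorem mul_map (p q : WreathSymInv M n) : (p * q).map = p.map.trans q.map := rfl

theorem one_tuple : (1 : WreathSymInv M n).tuple = 1 := rfl

theorem one_map : (1 : WreathSymInv M n).map = PEquiv.refl (Fin n) := rfl

instance : Monoid (WreathSymInv M n) where
  mul_assoc p q r := by
    apply WreathSymInv.ext
    · funext i
      rcases h : p.map i with _ | j
      · simp [mul_tuple, mul_map, SymInv.act, h]
      · have ht : (p.map.trans q.map) i = q.map j := by
          change (p.map i).bind q.map = q.map j
          rw [h]
          rfl
        simp [mul_tuple, mul_map, SymInv.act, h, ht, mul_assoc]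
    · exact PEquiv.trans_assoc _ _ _
  one_mul p := by
    apply WreathSymInv.ext
    · funext i
      simp [mul_tuple, one_tuple, one_map, SymInv.act]
    · exact PEquiv.refl_trans _
  mul_one p := by
    apply WreathSymInv.ext
    · funext i
      have hp := Set.ext_iff.1 p.supp_eq_dom i
      simp only [SymInv.dom, Function.mem_support, Set.mem_ofPred_eq] at hp
      rcases h : p.map i with _ | j
      · have hi : p.tuple i = 0 := by
          by_contra hne
          obtain ⟨j, hj⟩ := hp.1 hne
          rw [h] at hj
          cases hj
        simp [mul_tuple, one_tuple, SymInv.act, h, hi]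
      · simp [mul_tuple, one_tuple, SymInv.act, h]
    · exact PEquiv.trans_refl _

open Classical in
/-- The copy in `M ≀ I_n` of `α ∈ I_n`: the pair of the `0`-`1`-tuple with support `dom α`
and `α`. -/
noncomputable def ofSymInv (α : SymInv n) : WreathSymInv M n where
  tuple := fun i => if i ∈ α.dom then 1 else 0
  map := α
  supp_eq_dom := by
    ext i
    simp

/-- The copy in `M ≀ I_n` of a tuple `a ∈ M^n` (all entries are different from `0`): the pair of
`a` and the identity map. -/
def ofTuple (a : Fin n → M) : WreathSymInv M n where
  tuple := fun i => (a i : WithZero M)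
  map := PEquiv.refl (Fin n)
  supp_eq_dom := by
    ext i
    simp [SymInv.dom]

end WreathSymInv

/-- The alphabet `{s_1, …, s_{n-1}} ∪ {e_1, …, e_n} ∪ X^{(1)} ∪ ⋯ ∪ X^{(n)}`, with indices
counted from `0`: the letters `s i`, where `i + 1 < n`, and `e i`, `x i a`, where `i < n` and
`a ∈ X`. -/
inductive WreathGen (X : Type u) (n : ℕ) : Type u
  | s (i : ℕ) (hi : i + 1 < n)
  | e (i : Fin n)
  | x (i : Fin n) (a : X)

namespace WreathGen

variable {X : Type u} {n : ℕ}

/-- The letter `s_i` as a word. -/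
def sw (i : ℕ) (hi : i + 1 < n) : FreeMonoid (WreathGen X n) := FreeMonoid.of (s i hi)

/-- The letter `e_i` as a word. -/
def ew (i : Fin n) : FreeMonoid (WreathGen X n) := FreeMonoid.of (e i)

/-- The letter `x^{(i)}` as a word. -/
def xw (i : Fin n) (a : X) : FreeMonoid (WreathGen X n) := FreeMonoid.of (x i a)

/-- The word `w^{(i)} = x_1^{(i)} ⋯ x_k^{(i)}` for a word `w = x_1 ⋯ x_k` over `X`. -/
def copy (i : Fin n) : FreeMonoid X →* FreeMonoid (WreathGen X n) := FreeMonoid.map (x i)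

end WreathGen

open WreathGen in
/-- The defining relations of `M ≀ I_n`, where `R` is a set of defining relations of `M`. -/
inductive WreathRel {X : Type u} (R : FreeMonoid X → FreeMonoid X → Prop) (n : ℕ) :
    FreeMonoid (WreathGen X n) → FreeMonoid (WreathGen X n) → Prop
  | s_sq (i : ℕ) (hi : i + 1 < n) : WreathRel R n (sw i hi * sw i hi) 1
  | s_comm (i j : ℕ) (hi : i + 1 < n) (hj : j + 1 < n) (hij : 1 < |(i : ℤ) - (j : ℤ)|) :
      WreathRel R n (sw i hi * sw j hj) (sw j hj * sw i hi)
  | s_braid (i j : ℕ) (hi : i + 1 < n) (hj : j + 1 < n) (hij : |(i : ℤ) - (j : ℤ)| = 1) :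
      WreathRel R n (sw i hi * sw j hj * sw i hi) (sw j hj * sw i hi * sw j hj)
  | e_sq (i : Fin n) : WreathRel R n (ew i * ew i) (ew i)
  | e_comm (i j : Fin n) : WreathRel R n (ew i * ew j) (ew j * ew i)
  | s_e_comm (i : ℕ) (hi : i + 1 < n) (j : Fin n) (hj : (j : ℕ) ≠ i) (hj' : (j : ℕ) ≠ i + 1) :
      WreathRel R n (sw i hi * ew j) (ew j * sw i hi)
  | s_e (i : ℕ) (hi : i + 1 < n) :
      WreathRel R n (sw i hi * ew ⟨i, Nat.lt_of_succ_lt hi⟩) (ew ⟨i + 1, hi⟩ * sw i hi)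
  | e_e_s (i : ℕ) (hi : i + 1 < n) :
      WreathRel R n (ew ⟨i, Nat.lt_of_succ_lt hi⟩ * ew ⟨i + 1, hi⟩ * sw i hi)
        (ew ⟨i, Nat.lt_of_succ_lt hi⟩ * ew ⟨i + 1, hi⟩)
  | rel_copy (i : Fin n) (p q : FreeMonoid X) (h : R p q) :
      WreathRel R n (copy i p) (copy i q)
  | x_comm (i j : Fin n) (hij : i ≠ j) (a b : X) :
      WreathRel R n (xw i a * xw j b) (xw j b * xw i a)
  | s_x_comm (i : ℕ) (hi : i + 1 < n) (j : Fin n) (hj : (j : ℕ) ≠ i) (hj' : (j : ℕ) ≠ i + 1)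
      (a : X) : WreathRel R n (sw i hi * xw j a) (xw j a * sw i hi)
  | s_x (i : ℕ) (hi : i + 1 < n) (a : X) :
      WreathRel R n (sw i hi * xw ⟨i, Nat.lt_of_succ_lt hi⟩ a) (xw ⟨i + 1, hi⟩ a * sw i hi)
  | e_x_comm (i j : Fin n) (hij : i ≠ j) (a : X) :
      WreathRel R n (ew i * xw j a) (xw j a * ew i)
  | e_x (i : Fin n) (a : X) : WreathRel R n (ew i * xw i a) (ew i)
  | x_e (i : Fin n) (a : X) : WreathRel R n (xw i a * ew i) (ew i)

/-- The image in `M ≀ I_n` of a letter: `s_i` goes to the transposition of `i` and `i + 1`, `e_i` to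
the partial identity omitting `i`, and `x^{(i)}` to the tuple with entry `φ(x)` in position `i` and
entries `1` elsewhere. -/
noncomputable def wreathLetter {X : Type u} {M : Type v} [Monoid M] (φ : FreeMonoid X →* M)
    (n : ℕ) : WreathGen X n → WreathSymInv M n
  | .s i hi => .ofSymInv (.transposition ⟨i, Nat.lt_of_succ_lt hi⟩ ⟨i + 1, hi⟩)
  | .e i => .ofSymInv (.omitPoint i)
  | .x i a => .ofTuple (Pi.mulSingle i (φ (FreeMonoid.of a)))

/-- The morphism from the free monoid on the alphabet of `M ≀ I_n` to `M ≀ I_n` that extends the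
assignment `wreathLetter`. -/
noncomputable def wreathHom {X : Type u} {M : Type v} [Monoid M] (φ : FreeMonoid X →* M)
    (n : ℕ) : FreeMonoid (WreathGen X n) →* WreathSymInv M n :=
  FreeMonoid.lift (wreathLetter φ n)

/-!
The homomorphism is onto because a partial permutation of a finite set extends to a permutation: each
element of `M ≀ I_n` is a product `diag a * perm σ`, where `diag a` is the tuple `a` over `M ∪ {0}`
together with the partial identity on its support, and `perm σ` is a permutation. The tuple is
determined by the product, and so is the restriction of `σ⁻¹` to the support of `a`, but nothing else
of `σ`.

For the kernel, let `f` be any homomorphism from the free monoid to a monoid `Q` which respects the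
relations. The same normal forms exist in `Q`:

* The images of the `s_i` satisfy the Coxeter relations, so that they extend to a homomorphism `S`
  from the symmetric group to `Q` (`IsCoxeterFamily.exists_permHom`). Mathlib does not provide this
  presentation of the symmetric group; it is proved by induction on the number of generators, with
  explicit coset representatives `s_m ⋯ s_k`.
* The letters `e_i` and `x^{(i)}`, for fixed `i`, define a homomorphism from `M ∪ {0}` to `Q` which
  sends `0` to `e_i`. For different `i` the images commute, which gives a homomorphism `T` on tuples
  (`exists_tupleHom_of_wreathRel`). Thus the idempotents and the copies of `M` are treated together.
* Permutations move past tuples by permuting the entries (`permHom_mul_tupleHom`), so that each word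
  has an image of the form `T a * S σ`, and the image in the wreath product is then `diag a * perm σ`.
* The product `T a * S σ` depends only on `a` and on the restriction of `σ⁻¹` to the support of `a`
  (`tupleHom_mul_permHom`), by conjugates of the relation `e_i e_{i+1} s_i = e_i e_{i+1}`.

Hence words with the same value in the wreath product have the same image under `f`
(`map_eq_of_wreathHom_eq`), in particular for the projection to the quotient by the congruence which
the relations generate.
-/

/-! ### The Coxeter presentation of the symmetric group -/

/-- The elements `s 0, …, s (m - 1)` of a monoid satisfy the Coxeter relations of type `A_m`.
The values of `s` at other indices play no role. -/
structure IsCoxeterFamily {Q : Type*} [Monoid Q] (m : ℕ) (s : ℕ → Q) : Prop where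
  sq : ∀ i < m, s i * s i = 1
  comm : ∀ i j, i + 1 < j → j < m → s i * s j = s j * s i
  braid : ∀ i, i + 1 < m → s i * s (i + 1) * s i = s (i + 1) * s i * s (i + 1)

namespace IsCoxeterFamily

variable {Q : Type*} [Monoid Q] {m : ℕ} {s : ℕ → Q}

theorem mono {m' : ℕ} (hs : IsCoxeterFamily m s) (h : m' ≤ m) : IsCoxeterFamily m' s where
  sq i hi := hs.sq i (hi.trans_le h)
  comm i j hij hj := hs.comm i j hij (hj.trans_le h)
  braid i hi := hs.braid i (hi.trans_le h)

/-- The product `s (k + d - 1) ⋯ s (k + 1) s k` of `d` consecutive elements. With `k + d = m + 1`,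
these are coset representatives of `⟨s 0, …, s (m - 1)⟩` in `⟨s 0, …, s m⟩`. -/
def chain (s : ℕ → Q) (k : ℕ) : ℕ → Q
  | 0 => 1
  | d + 1 => chain s (k + 1) d * s k

theorem chain_mul_of_lt (hs : IsCoxeterFamily m s) {j : ℕ} (d k : ℕ) (hj : j + 1 < k)
    (hk : k + d ≤ m) : chain s k d * s j = s j * chain s k d := by
  induction d generalizing k with
  | zero => simp [chain]
  | succ d ih =>
    rw [chain, mul_assoc, ← hs.comm j k hj (by omega), ← mul_assoc, ih (k + 1) (by omega) (by omega),
      mul_assoc]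

theorem chain_mul_of_gt (hs : IsCoxeterFamily m s) {j : ℕ} (d k : ℕ) (hj : k < j + 1)
    (hjd : j + 1 < k + d) (hk : k + d ≤ m) :
    chain s k d * s (j + 1) = s j * chain s k d := by
  induction d generalizing k with
  | zero => omega
  | succ d ih =>
    rcases (Nat.lt_succ_iff.1 hj).eq_or_lt with rfl | h
    · obtain ⟨d, rfl⟩ : ∃ d', d = d' + 1 := ⟨d - 1, by omega⟩
      have hb := hs.braid k (by omega)
      have hc := hs.chain_mul_of_lt (j := k) d (k + 1 + 1) (by omega) (by omega)
      rw [chain, chain, mul_assoc, mul_assoc, ← mul_assoc (s (k + 1)), ← hb, mul_assoc (s k),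
        ← mul_assoc, hc, mul_assoc, mul_assoc]
    · rw [chain, mul_assoc, hs.comm k (j + 1) (by omega) (by omega), ← mul_assoc,
        ih (k + 1) (by omega) (by omega) (by omega), mul_assoc]

theorem exists_eq_mul_chain (hs : IsCoxeterFamily (m + 1) s) {x : Q}
    (hx : x ∈ Submonoid.closure (s '' {i | i < m + 1})) :
    ∃ g ∈ Submonoid.closure (s '' {i | i < m}), ∃ k d, k + d = m + 1 ∧ x = g * chain s k d := by
  induction hx using Submonoid.closure_induction_right with
  | one => exact ⟨1, one_mem _, m + 1, 0, rfl, by simp [chain]⟩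
  | mul_right x _ y hy ih =>
    obtain ⟨j, hj : j < m + 1, rfl⟩ := hy
    obtain ⟨g, hg, k, d, hkd, rfl⟩ := ih
    have hmem : ∀ i < m, g * s i ∈ Submonoid.closure (s '' {i | i < m}) := fun i hi =>
      mul_mem hg (Submonoid.subset_closure ⟨i, hi, rfl⟩)
    rcases lt_trichotomy k j with h | rfl | h
    · obtain ⟨j, rfl⟩ : ∃ j', j = j' + 1 := ⟨j - 1, by omega⟩
      refine ⟨g * s j, hmem j (by omega), k, d, hkd, ?_⟩
      rw [mul_assoc, hs.chain_mul_of_gt d k h (by omega) hkd.le, mul_assoc]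
    · obtain ⟨d, rfl⟩ : ∃ d', d = d' + 1 := ⟨d - 1, by omega⟩
      refine ⟨g, hg, k + 1, d, by omega, ?_⟩
      rw [chain, mul_assoc, mul_assoc, hs.sq k hj, mul_one]
    · rcases (Nat.succ_le_iff.2 h).eq_or_lt with rfl | h'
      · exact ⟨g, hg, j, d + 1, by omega, by rw [chain, mul_assoc]⟩
      · refine ⟨g * s j, hmem j (by omega), k, d, hkd, ?_⟩
        rw [mul_assoc, hs.chain_mul_of_lt d k h' hkd.le, mul_assoc]

theorem swap_nat (m : ℕ) :
    IsCoxeterFamily m fun i => (Equiv.swap i (i + 1) : Equiv.Perm ℕ) where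
  sq i _ := Equiv.swap_mul_self _ _
  comm i j h _ := by
    ext x
    simp only [Equiv.Perm.coe_mul, Function.comp_apply, Equiv.swap_apply_def]
    split_ifs <;> omega
  braid i _ := by
    ext x
    simp only [Equiv.Perm.coe_mul, Function.comp_apply, Equiv.swap_apply_def]
    split_ifs <;> omega

theorem prodMk {P : Type*} [Monoid P] {t : ℕ → P} (hs : IsCoxeterFamily m s)
    (ht : IsCoxeterFamily m t) : IsCoxeterFamily m fun i => (s i, t i) where
  sq i hi := Prod.ext (hs.sq i hi) (ht.sq i hi)
  comm i j h hj := Prod.ext (hs.comm i j h hj) (ht.comm i j h hj)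
  braid i hi := Prod.ext (hs.braid i hi) (ht.braid i hi)

theorem chain_snd_apply (s : ℕ → Q) (k d : ℕ) :
    (chain (fun i => (s i, (Equiv.swap i (i + 1) : Equiv.Perm ℕ))) k d).2 k = k + d := by
  induction d generalizing k with
  | zero => rfl
  | succ d ih =>
    rw [chain, Prod.snd_mul, Equiv.Perm.mul_apply, Equiv.swap_apply_left, ih]
    omega

theorem snd_apply_of_mem_closure {x : Q × Equiv.Perm ℕ}
    (hx : x ∈ Submonoid.closure ((fun i => (s i, Equiv.swap i (i + 1))) '' {i | i < m}))
    {l : ℕ} (hl : m < l) : x.2 l = l := by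
  induction hx using Submonoid.closure_induction with
  | one => rfl
  | mem x hx =>
    obtain ⟨i, hi : i < m, rfl⟩ := hx
    exact Equiv.swap_apply_of_ne_of_ne (by omega) (by omega)
  | mul x y _ _ hx hy => rw [Prod.snd_mul, Equiv.Perm.mul_apply, hy, hx]

/-- Words in a Coxeter family are determined by the permutations which they represent. Here the
pairs of values of a word in `Q` and in `Equiv.Perm ℕ` form a submonoid of the product. The proof
is by induction on `m`: in the form `g * chain k d`, with one generator more, the
permutation determines `k` as the preimage of the last point `m + 1`. -/
theorem eq_of_snd_eq (hs : IsCoxeterFamily m s) {x y : Q × Equiv.Perm ℕ}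
    (hx : x ∈ Submonoid.closure ((fun i => (s i, Equiv.swap i (i + 1))) '' {i | i < m}))
    (hy : y ∈ Submonoid.closure ((fun i => (s i, Equiv.swap i (i + 1))) '' {i | i < m}))
    (hxy : x.2 = y.2) : x = y := by
  induction m generalizing x y with
  | zero =>
    simp only [not_lt_zero, Set.ofPred_false, Set.image_empty, Submonoid.closure_empty,
      Submonoid.mem_bot] at hx hy
    rw [hx, hy]
  | succ m ih =>
    have ht := hs.prodMk (swap_nat (m + 1))
    obtain ⟨g, hg, k, d, hkd, rfl⟩ := ht.exists_eq_mul_chain hx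
    obtain ⟨h, hh, k', d', hkd', rfl⟩ := ht.exists_eq_mul_chain hy
    have key : ∀ {g : Q × Equiv.Perm ℕ} {k d : ℕ}, k + d = m + 1 →
        g ∈ Submonoid.closure ((fun i => (s i, Equiv.swap i (i + 1))) '' {i | i < m}) →
        (g * chain (fun i => (s i, (Equiv.swap i (i + 1) : Equiv.Perm ℕ))) k d).2 k = m + 1 := by
      intro g k d hkd hg
      rw [Prod.snd_mul, Equiv.Perm.mul_apply, chain_snd_apply, hkd,
        snd_apply_of_mem_closure hg (Nat.lt_succ_self m)]
    have hk : k = k' := by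
      refine Equiv.injective _ ((key hkd hg).trans ?_)
      rw [hxy, key hkd' hh]
    subst hk
    obtain rfl : d = d' := by omega
    rw [Prod.snd_mul, Prod.snd_mul] at hxy
    rw [ih (hs.mono (Nat.le_succ m)) hg hh (mul_right_cancel hxy)]

/-- The Coxeter presentation of the symmetric group, as a universal property: a Coxeter family of
`m` elements is the image of the simple transpositions of `m + 1` points under a homomorphism. -/
theorem exists_permHom (hs : IsCoxeterFamily m s) :
    ∃ f : Equiv.Perm (Fin (m + 1)) →* Q,
      ∀ i : Fin m, f (Equiv.swap i.castSucc i.succ) = s i := by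
  -- `N` is the graph of the homomorphism to be constructed.
  let N : Submonoid (Q × Equiv.Perm (Fin (m + 1))) :=
    Submonoid.closure (Set.range fun i : Fin m => (s i, Equiv.swap i.castSucc i.succ))
  let p : N →* Equiv.Perm (Fin (m + 1)) := (MonoidHom.snd Q _).comp N.subtype
  let j : Q × Equiv.Perm (Fin (m + 1)) →* Q × Equiv.Perm ℕ :=
    (MonoidHom.id Q).prodMap (Equiv.Perm.viaEmbeddingHom Fin.valEmbedding)
  have hj : N ≤ (Submonoid.closure
      ((fun i => (s i, Equiv.swap i (i + 1))) '' {i | i < m})).comap j := by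
    refine Submonoid.closure_le.2 ?_
    rintro _ ⟨i, rfl⟩
    refine Submonoid.subset_closure ⟨i, i.2, Prod.ext rfl (Equiv.ext fun x => ?_)⟩
    change Equiv.swap (i : ℕ) (i + 1) x =
      (Equiv.swap i.castSucc i.succ).viaEmbedding Fin.valEmbedding x
    by_cases hx : x < m + 1
    · have := Equiv.Perm.viaEmbedding_apply (Equiv.swap i.castSucc i.succ) Fin.valEmbedding ⟨x, hx⟩
      refine Eq.trans ?_ this.symm
      simp only [Equiv.swap_apply_def, Fin.ext_iff, Fin.val_castSucc, Fin.val_succ,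
        Fin.valEmbedding_apply]
      split_ifs <;> rfl
    · rw [Equiv.Perm.viaEmbedding_apply_of_notMem, Equiv.swap_apply_of_ne_of_ne]
      · omega
      · omega
      · rintro ⟨y, rfl⟩
        exact hx y.2
  have hinj : Function.Injective p := by
    intro x y hxy
    have h := hs.eq_of_snd_eq (hj x.2) (hj y.2)
      (congrArg (Equiv.Perm.viaEmbeddingHom Fin.valEmbedding) hxy)
    have h1 : x.1.1 = y.1.1 := congrArg (fun z : Q × Equiv.Perm ℕ => z.1) h
    exact Subtype.ext (Prod.ext h1 hxy)
  have hsurj : Function.Surjective p := by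
    rw [← MonoidHom.mrange_eq_top, eq_top_iff, ← Equiv.Perm.mclosure_swap_castSucc_succ,
      Submonoid.closure_le]
    rintro _ ⟨i, rfl⟩
    exact ⟨⟨_, Submonoid.subset_closure ⟨i, rfl⟩⟩, rfl⟩
  let e := MulEquiv.ofBijective p ⟨hinj, hsurj⟩
  refine ⟨((MonoidHom.fst Q _).comp N.subtype).comp e.symm.toMonoidHom, fun i => ?_⟩
  have : e.symm (Equiv.swap i.castSucc i.succ) =
      ⟨(s i, Equiv.swap i.castSucc i.succ), Submonoid.subset_closure ⟨i, rfl⟩⟩ := by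
    rw [MulEquiv.symm_apply_eq]
    rfl
  change (e.symm (Equiv.swap i.castSucc i.succ)).1.1 = s i
  rw [this]

end IsCoxeterFamily

/-! ### Diagonal elements and permutations in the wreath product -/

namespace WreathSymInv

variable {M : Type v} [Monoid M] {n : ℕ}

theorem trans_apply_eq_bind (α β : SymInv n) (i : Fin n) : (α.trans β) i = (α i).bind β := rfl

theorem dom_eq_ne_none (α : SymInv n) (i : Fin n) : i ∈ α.dom ↔ α i ≠ none := by
  rw [Option.ne_none_iff_exists']
  rfl

theorem tuple_eq_zero_iff (p : WreathSymInv M n) (i : Fin n) : p.tuple i = 0 ↔ p.map i = none := by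
  have := Set.ext_iff.1 p.supp_eq_dom i
  rwa [dom_eq_ne_none, Function.mem_support, not_iff_not] at this

open Classical in
theorem ofSet_apply (A : Set (Fin n)) (i : Fin n) :
    PEquiv.ofSet A i = if i ∈ A then some i else none := rfl

open Classical in
/-- The diagonal element `(a, id)` of the wreath product, where `id` is the partial identity on the
support of the tuple `a` over `M ∪ {0}`. -/
noncomputable def diag : (Fin n → WithZero M) →* WreathSymInv M n where
  toFun a :=
    { tuple := a
      map := PEquiv.ofSet (Function.support a)
      supp_eq_dom := by
        ext i
        rw [dom_eq_ne_none, ofSet_apply]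
        simp }
  map_one' := WreathSymInv.ext rfl <| PEquiv.ext fun i => by simp [one_map]
  map_mul' a b := by
    refine WreathSymInv.ext (funext fun i => ?_) (PEquiv.ext fun i => ?_)
    · by_cases h : a i = 0 <;> simp [mul_tuple, SymInv.act, ofSet_apply, h]
    · rw [mul_map, trans_apply_eq_bind, ofSet_apply, ofSet_apply]
      by_cases h : a i = 0 <;> simp [ofSet_apply, h]

/-- Permutations as elements of the wreath product. The product of permutations is composition from
right to left and that of partial permutations is composition from left to right, so that `σ` goes
to the pair of the tuple `(1, …, 1)` and `σ⁻¹`. -/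
def perm : Equiv.Perm (Fin n) →* WreathSymInv M n where
  toFun σ :=
    { tuple := 1
      map := (σ⁻¹ : Equiv.Perm (Fin n)).toPEquiv
      supp_eq_dom := by
        ext i
        rw [dom_eq_ne_none]
        simp }
  map_one' := WreathSymInv.ext rfl <| PEquiv.ext fun i => by simp [one_map]
  map_mul' σ τ := WreathSymInv.ext (funext fun i => by simp [mul_tuple, SymInv.act]) <|
    PEquiv.ext fun i => by simp [mul_map, trans_apply_eq_bind]

theorem diag_mul_perm_tuple (a : Fin n → WithZero M) (σ : Equiv.Perm (Fin n)) :
    (diag a * perm σ).tuple = a := by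
  funext i
  by_cases h : a i = 0 <;> simp [mul_tuple, diag, perm, SymInv.act, ofSet_apply, h]

open Classical in
theorem diag_mul_perm_map (a : Fin n → WithZero M) (σ : Equiv.Perm (Fin n)) (i : Fin n) :
    (diag a * perm σ).map i = if a i = 0 then none else some (σ⁻¹ i) := by
  by_cases h : a i = 0 <;> simp [mul_map, trans_apply_eq_bind, diag, perm, ofSet_apply, h]

theorem perm_mul_diag (σ : Equiv.Perm (Fin n)) (a : Fin n → WithZero M) :
    perm σ * diag a = diag (fun i => a (σ⁻¹ i)) * perm σ := by
  refine WreathSymInv.ext (funext fun i => ?_) (PEquiv.ext fun i => ?_)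
  · rw [diag_mul_perm_tuple]
    simp [mul_tuple, perm, diag, SymInv.act]
  · rw [diag_mul_perm_map]
    by_cases h : a (σ⁻¹ i) = 0 <;>
      simp_all [mul_map, trans_apply_eq_bind, diag, perm, ofSet_apply]

theorem exists_eq_diag_mul_perm (p : WreathSymInv M n) : ∃ a σ, p = diag a * perm σ := by
  classical
  -- A partial permutation of a finite set extends to a permutation.
  obtain ⟨g, hg⟩ := Set.MapsTo.exists_equiv_extend_of_card_eq (t := Finset.univ)
    (s := {i | p.map i ≠ none}) (f := fun i => (p.map i).getD i) (by simp) (by simp [Set.MapsTo])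
    (by
      intro i hi j hj hij
      obtain ⟨k, hk⟩ := Option.ne_none_iff_exists'.1 hi
      obtain ⟨l, hl⟩ := Option.ne_none_iff_exists'.1 hj
      have : k = l := by simpa [hk, hl] using hij
      exact p.map.inj hk (this ▸ hl))
  let τ : Equiv.Perm (Fin n) := g.trans (Equiv.subtypeUnivEquiv Finset.mem_univ)
  refine ⟨p.tuple, τ⁻¹, WreathSymInv.ext (diag_mul_perm_tuple _ _).symm (PEquiv.ext fun i => ?_)⟩
  rw [diag_mul_perm_map, inv_inv]
  split_ifs with h
  · exact (tuple_eq_zero_iff p i).1 h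
  · rw [tuple_eq_zero_iff] at h
    obtain ⟨k, hk⟩ := Option.ne_none_iff_exists'.1 h
    have : τ i = k := (hg i h).trans (by simp [hk])
    rw [hk, this]

theorem ofSymInv_transposition (i j : Fin n) :
    (ofSymInv (SymInv.transposition i j) : WreathSymInv M n) = perm (Equiv.swap i j) := by
  refine WreathSymInv.ext (funext fun k => ?_) rfl
  have : k ∈ (SymInv.transposition i j).dom := by simp [dom_eq_ne_none, SymInv.transposition]
  simp [ofSymInv, perm, this]

theorem ofSymInv_omitPoint (i : Fin n) :
    (ofSymInv (SymInv.omitPoint i) : WreathSymInv M n) = diag (Pi.mulSingle i 0) := by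
  have hd : ∀ j, SymInv.omitPoint i j = if j = i then none else some j := fun j => by
    by_cases h : j = i <;> simp [SymInv.omitPoint, PEquiv.ofSet, h]
  refine WreathSymInv.ext (funext fun j => ?_) (PEquiv.ext fun j => ?_)
  · by_cases h : j = i <;> simp [ofSymInv, diag, dom_eq_ne_none, hd, h]
  · by_cases h : j = i <;> simp [ofSymInv, diag, ofSet_apply, hd, h]

theorem ofTuple_mulSingle (i : Fin n) (m : M) :
    ofTuple (Pi.mulSingle i m) = diag (Pi.mulSingle i (m : WithZero M)) := by
  have : ∀ j, ((Pi.mulSingle i m : Fin n → M) j : WithZero M) =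
      (Pi.mulSingle i (m : WithZero M) : Fin n → WithZero M) j := fun j => by
    by_cases h : j = i <;> simp [h]
  refine WreathSymInv.ext (funext this) (PEquiv.ext fun j => ?_)
  simp [ofTuple, diag, ofSet_apply, ← this]

end WreathSymInv

section

open WreathSymInv

variable {X : Type u} {M : Type v} [Monoid M] {n : ℕ} (φ : FreeMonoid X →* M)

theorem wreathHom_sw (i : ℕ) (hi : i + 1 < n) :
    wreathHom φ n (WreathGen.sw i hi) =
      perm (Equiv.swap ⟨i, Nat.lt_of_succ_lt hi⟩ ⟨i + 1, hi⟩) :=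
  (FreeMonoid.lift_eval_of _ _).trans (ofSymInv_transposition _ _)

theorem wreathHom_ew (i : Fin n) : wreathHom φ n (WreathGen.ew i) = diag (Pi.mulSingle i 0) :=
  (FreeMonoid.lift_eval_of _ _).trans (ofSymInv_omitPoint i)

theorem wreathHom_xw (i : Fin n) (a : X) :
    wreathHom φ n (WreathGen.xw i a) =
      diag (Pi.mulSingle i (φ (FreeMonoid.of a) : WithZero M)) :=
  (FreeMonoid.lift_eval_of _ _).trans (ofTuple_mulSingle i _)

theorem wreathHom_copy (i : Fin n) (w : FreeMonoid X) :
    wreathHom φ n (WreathGen.copy i w) = diag (Pi.mulSingle i (φ w : WithZero M)) := by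
  induction w using FreeMonoid.recOn with
  | one => simp
  | of_mul a w ih =>
    rw [map_mul, map_mul, ih, map_mul, WithZero.coe_mul, Pi.mulSingle_mul, map_mul]
    exact congrArg (· * _) (wreathHom_xw φ i a)

theorem mulSingle_inv_apply (σ : Equiv.Perm (Fin n)) (i : Fin n) (z : WithZero M) :
    (fun j => (Pi.mulSingle i z : Fin n → WithZero M) (σ⁻¹ j)) = Pi.mulSingle (σ i) z := by
  funext j
  by_cases h : j = σ i
  · simp [h]
  · simp [h, Equiv.symm_apply_eq]

theorem perm_mul_diag_mulSingle (σ : Equiv.Perm (Fin n)) (i : Fin n) (z : WithZero M) :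
    perm σ * diag (Pi.mulSingle i z) = diag (Pi.mulSingle (σ i) z) * perm σ := by
  rw [perm_mul_diag, mulSingle_inv_apply]

theorem wreathHom_surjective (hφ : Function.Surjective φ) :
    Function.Surjective (wreathHom φ n) := by
  intro p
  obtain ⟨a, σ, rfl⟩ := exists_eq_diag_mul_perm p
  rw [← MonoidHom.mem_mrange]
  refine mul_mem ?_ ?_
  · refine Submonoid.pi_mem_of_mulSingle_mem (H := (MonoidHom.mrange (wreathHom φ n)).comap diag)
      a fun i => ?_
    rcases a i with _ | m
    · exact ⟨_, wreathHom_ew φ i⟩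
    · obtain ⟨w, rfl⟩ := hφ m
      exact ⟨_, wreathHom_copy φ i w⟩
  · cases n with
    | zero => exact Subsingleton.elim (1 : Equiv.Perm (Fin 0)) σ ▸ map_one (perm (M := M)) ▸ one_mem _
    | succ m =>
      have : (⊤ : Submonoid _) ≤ (MonoidHom.mrange (wreathHom φ (m + 1))).comap perm := by
        rw [← Equiv.Perm.mclosure_swap_castSucc_succ, Submonoid.closure_le]
        rintro _ ⟨i, rfl⟩
        exact ⟨_, wreathHom_sw φ i (Nat.succ_lt_succ i.2)⟩
      exact this (Submonoid.mem_top σ)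

theorem wreathHom_eq_of_rel {R : FreeMonoid X → FreeMonoid X → Prop}
    (hR : ∀ p q, R p q → φ p = φ q) {u w : FreeMonoid (WreathGen X n)} (h : WreathRel R n u w) :
    wreathHom φ n u = wreathHom φ n w := by
  cases h with
  | s_sq i hi => rw [map_mul, wreathHom_sw, ← map_mul, Equiv.swap_mul_self, map_one, map_one]
  | s_comm i j hi hj hij =>
    simp only [map_mul, wreathHom_sw]
    rw [← map_mul, ← map_mul]
    congr 1
    ext x
    simp only [Equiv.Perm.coe_mul, Function.comp_apply, Equiv.swap_apply_def, Fin.ext_iff]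
    grind
  | s_braid i j hi hj hij =>
    simp only [map_mul, wreathHom_sw]
    simp only [← map_mul]
    congr 1
    ext x
    simp only [Equiv.Perm.coe_mul, Function.comp_apply, Equiv.swap_apply_def, Fin.ext_iff]
    grind
  | e_sq i => rw [map_mul, wreathHom_ew, ← map_mul, ← Pi.mulSingle_mul, mul_zero]
  | e_comm i j =>
    rw [map_mul, map_mul, wreathHom_ew, wreathHom_ew, ← map_mul, ← map_mul]
    congr 1
    by_cases h : i = j
    · rw [h]
    · exact Pi.mulSingle_commute h _ _
  | s_e_comm i hi j hj hj' =>
    rw [map_mul, map_mul, wreathHom_ew, wreathHom_sw, perm_mul_diag_mulSingle,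
      Equiv.swap_apply_of_ne_of_ne (Fin.ne_of_val_ne hj) (Fin.ne_of_val_ne hj')]
  | s_e i hi =>
    rw [map_mul, map_mul, wreathHom_ew, wreathHom_ew, wreathHom_sw, perm_mul_diag_mulSingle,
      Equiv.swap_apply_left]
  | e_e_s i hi =>
    rw [map_mul, map_mul, wreathHom_ew, wreathHom_ew, wreathHom_sw, ← map_mul]
    refine WreathSymInv.ext (diag_mul_perm_tuple _ _) (PEquiv.ext fun j => ?_)
    rw [diag_mul_perm_map, ← mul_one (diag _), ← map_one perm, diag_mul_perm_map]
    split_ifs with h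
    · rfl
    · have h1 : j ≠ ⟨i, Nat.lt_of_succ_lt hi⟩ := by
        rintro rfl
        simp at h
      have h2 : j ≠ ⟨i + 1, hi⟩ := by
        rintro rfl
        simp at h
      rw [Equiv.swap_inv, Equiv.swap_apply_of_ne_of_ne h1 h2, inv_one, Equiv.Perm.one_apply]
  | rel_copy i p q h => rw [wreathHom_copy, wreathHom_copy, hR p q h]
  | x_comm i j hij a b =>
    rw [map_mul, map_mul, wreathHom_xw, wreathHom_xw, ← map_mul, ← map_mul,
      Pi.mulSingle_commute hij]
  | s_x_comm i hi j hj hj' a =>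
    rw [map_mul, map_mul, wreathHom_xw, wreathHom_sw, perm_mul_diag_mulSingle,
      Equiv.swap_apply_of_ne_of_ne (Fin.ne_of_val_ne hj) (Fin.ne_of_val_ne hj')]
  | s_x i hi a =>
    rw [map_mul, map_mul, wreathHom_xw, wreathHom_xw, wreathHom_sw, perm_mul_diag_mulSingle,
      Equiv.swap_apply_left]
  | e_x_comm i j hij a =>
    rw [map_mul, map_mul, wreathHom_ew, wreathHom_xw, ← map_mul, ← map_mul,
      Pi.mulSingle_commute hij]
  | e_x i a =>
    rw [map_mul, wreathHom_ew, wreathHom_xw, ← map_mul, ← Pi.mulSingle_mul, zero_mul]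
  | x_e i a =>
    rw [map_mul, wreathHom_ew, wreathHom_xw, ← map_mul, ← Pi.mulSingle_mul, mul_zero]

end

/-! ### Normal forms modulo the relations -/

section

open WreathSymInv WreathGen

variable {X : Type u} {M : Type v} [Monoid M] {n : ℕ} {R : FreeMonoid X → FreeMonoid X → Prop}
  {φ : FreeMonoid X →* M} {Q : Type*} [Monoid Q] {f : FreeMonoid (WreathGen X n) →* Q}

/-- The letters `s_i` generate an image of the symmetric group. -/
theorem exists_permHom_of_wreathRel (hf : ∀ u w, WreathRel R n u w → f u = f w) :
    ∃ S : Equiv.Perm (Fin n) →* Q, ∀ (i : ℕ) (hi : i + 1 < n),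
      S (Equiv.swap ⟨i, Nat.lt_of_succ_lt hi⟩ ⟨i + 1, hi⟩) = f (sw i hi) := by
  cases n with
  | zero => exact ⟨1, fun i hi => absurd hi (Nat.not_lt_zero _)⟩
  | succ m =>
    let s : ℕ → Q := fun i => if h : i + 1 < m + 1 then f (sw i h) else 1
    have hs : ∀ i (h : i < m), s i = f (sw i (Nat.succ_lt_succ h)) := fun i h =>
      dif_pos (Nat.succ_lt_succ h)
    have hcox : IsCoxeterFamily m s :=
      { sq := fun i hi => by
          rw [hs i hi, ← map_mul, hf _ _ (.s_sq i _), map_one]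
        comm := fun i j hij hj => by
          rw [hs i (by omega), hs j hj, ← map_mul, ← map_mul,
            hf _ _ (.s_comm i j _ _ (by rw [lt_abs]; omega))]
        braid := fun i hi => by
          rw [hs i (by omega), hs (i + 1) hi, ← map_mul, ← map_mul, ← map_mul, ← map_mul,
            hf _ _ (.s_braid i (i + 1) _ _ (by simp))] }
    obtain ⟨S, hS⟩ := hcox.exists_permHom
    exact ⟨S, fun i hi => (hS ⟨i, Nat.lt_of_succ_lt_succ hi⟩).trans (hs i (Nat.lt_of_succ_lt_succ hi))⟩

/-- A family which the simple transpositions permute by conjugation like the points `0, …, n - 1`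
is permuted in the same way by all permutations. -/
theorem permHom_mul_eq (hf : ∀ u w, WreathRel R n u w → f u = f w)
    {S : Equiv.Perm (Fin n) →* Q}
    (hS : ∀ (i : ℕ) (hi : i + 1 < n),
      S (Equiv.swap ⟨i, Nat.lt_of_succ_lt hi⟩ ⟨i + 1, hi⟩) = f (sw i hi))
    {y : Fin n → Q}
    (h1 : ∀ (i : ℕ) (hi : i + 1 < n) (j : Fin n), (j : ℕ) ≠ i → (j : ℕ) ≠ i + 1 →
      f (sw i hi) * y j = y j * f (sw i hi))
    (h2 : ∀ (i : ℕ) (hi : i + 1 < n),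
      f (sw i hi) * y ⟨i, Nat.lt_of_succ_lt hi⟩ = y ⟨i + 1, hi⟩ * f (sw i hi))
    (σ : Equiv.Perm (Fin n)) (j : Fin n) : S σ * y j = y (σ j) * S σ := by
  cases n with
  | zero => exact j.elim0
  | succ m =>
    have hσ : σ ∈ (⊤ : Submonoid (Equiv.Perm (Fin (m + 1)))) := Submonoid.mem_top σ
    rw [← Equiv.Perm.mclosure_swap_castSucc_succ] at hσ
    induction hσ using Submonoid.closure_induction generalizing j with
    | one => simp
    | mul σ τ _ _ hσ hτ =>
      rw [map_mul, mul_assoc, hτ, ← mul_assoc, hσ, mul_assoc, Equiv.Perm.mul_apply]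
    | mem σ hσ =>
      obtain ⟨⟨i, hi⟩, rfl⟩ := hσ
      have hi' := Nat.succ_lt_succ hi
      have hS' : S (Equiv.swap (Fin.castSucc ⟨i, hi⟩) (Fin.succ ⟨i, hi⟩)) = f (sw i hi') := hS i hi'
      simp only [hS']
      rcases eq_or_ne j (Fin.castSucc ⟨i, hi⟩) with rfl | hj
      · rw [Equiv.swap_apply_left]
        exact h2 i hi'
      rcases eq_or_ne j (Fin.succ ⟨i, hi⟩) with rfl | hj'
      · rw [Equiv.swap_apply_right]
        -- This case is `h2` multiplied by the involution `f (sw i hi')` on both sides.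
        have hsq : f (sw i hi') * f (sw i hi') = 1 := by
          rw [← map_mul, hf _ _ (.s_sq i hi'), map_one]
        have h := congrArg (fun q => f (sw i hi') * q * f (sw i hi')) (h2 i hi')
        simp only [mul_assoc, hsq, mul_one] at h
        rw [← mul_assoc, hsq, one_mul] at h
        exact h.symm
      · rw [Equiv.swap_apply_of_ne_of_ne hj hj']
        exact h1 i hi' j (fun h => hj (Fin.ext h)) (fun h => hj' (Fin.ext h))

theorem map_copy_commute {i : Fin n} {q : Q} (h : ∀ a, Commute q (f (xw i a)))
    (w : FreeMonoid X) : Commute q (f (copy i w)) := by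
  induction w using FreeMonoid.recOn with
  | one => simp
  | of_mul a w ih =>
    rw [map_mul, map_mul]
    exact (h a).mul_right ih

theorem map_ew_mul_copy (hf : ∀ u w, WreathRel R n u w → f u = f w) (i : Fin n)
    (w : FreeMonoid X) : f (ew i) * f (copy i w) = f (ew i) := by
  induction w using FreeMonoid.recOn with
  | one => simp
  | of_mul a w ih =>
    have : f (ew i) * f (copy i (FreeMonoid.of a)) = f (ew i) :=
      (map_mul f _ _).symm.trans (hf _ _ (.e_x i a))
    rw [map_mul, map_mul, ← mul_assoc, this, ih]

theorem map_copy_mul_ew (hf : ∀ u w, WreathRel R n u w → f u = f w) (i : Fin n)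
    (w : FreeMonoid X) : f (copy i w) * f (ew i) = f (ew i) := by
  induction w using FreeMonoid.recOn with
  | one => simp
  | of_mul a w ih =>
    have : f (copy i (FreeMonoid.of a)) * f (ew i) = f (ew i) :=
      (map_mul f _ _).symm.trans (hf _ _ (.x_e i a))
    rw [map_mul, map_mul, mul_assoc, ih, this]

/-- The relations which involve only the letters with index `i` define a copy of the monoid
`M ∪ {0}`, in which `e_i` is the zero. It is not the zero of `Q`, so that this is only a
homomorphism of monoids. -/
theorem exists_localHom_of_wreathRel (hφ : HasMonoidPresentation R φ)
    (hf : ∀ u w, WreathRel R n u w → f u = f w) (i : Fin n) :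
    ∃ D : WithZero M →* Q, D 0 = f (ew i) ∧ ∀ w, D (φ w : WithZero M) = f (copy i w) := by
  have hle : Con.ker φ ≤ Con.ker (f.comp (copy i)) := by
    rw [hφ.2, Con.conGen_le]
    exact fun p q h => hf _ _ (.rel_copy i p q h)
  have hext : ∀ w w', φ w = φ w' → f (copy i w) = f (copy i w') := fun w w' h => hle h
  choose g hg using hφ.1
  refine ⟨
    { toFun := fun z => z.recZeroCoe (f (ew i)) fun m => f (copy i (g m))
      map_one' := (hext _ 1 (by rw [hg, map_one]; rfl)).trans (by simp)
      map_mul' := fun y z => ?_ }, rfl, fun w => hext _ _ (hg _)⟩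
  rcases y with _ | y <;> rcases z with _ | z
  · exact ((map_mul f _ _).symm.trans (hf _ _ (.e_sq i))).symm
  · exact (map_ew_mul_copy hf i _).symm
  · exact (map_copy_mul_ew hf i _).symm
  · change f (copy i (g (y * z))) = f (copy i (g y)) * f (copy i (g z))
    rw [← map_mul, ← map_mul]
    exact hext _ _ (by rw [map_mul, hg, hg, hg])

/-- Letters with different indices commute, so that the copies of `M ∪ {0}` combine to a homomorphism
on tuples. -/
theorem exists_tupleHom_of_wreathRel (hφ : HasMonoidPresentation R φ)
    (hf : ∀ u w, WreathRel R n u w → f u = f w) :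
    ∃ T : (Fin n → WithZero M) →* Q, (∀ i, T (Pi.mulSingle i 0) = f (ew i)) ∧
      ∀ i w, T (Pi.mulSingle i (φ w : WithZero M)) = f (copy i w) := by
  choose D hD0 hD using exists_localHom_of_wreathRel hφ hf
  have hex : ∀ i j, i ≠ j → ∀ w, Commute (f (ew i)) (f (copy j w)) := fun i j hij =>
    map_copy_commute fun a => by
      rw [Commute, SemiconjBy, ← map_mul, ← map_mul]
      exact hf _ _ (.e_x_comm i j hij a)
  have hxx : ∀ i j, i ≠ j → ∀ w w', Commute (f (copy i w)) (f (copy j w')) := fun i j hij w =>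
    map_copy_commute fun a => (map_copy_commute (fun b => by
      rw [Commute, SemiconjBy, ← map_mul, ← map_mul]
      exact hf _ _ (.x_comm j i hij.symm a b)) w).symm
  have hcomm : Pairwise fun i j => ∀ y z, Commute (D i y) (D j z) := by
    intro i j hij y z
    induction y with
    | zero =>
      induction z with
      | zero =>
        rw [hD0, hD0, Commute, SemiconjBy, ← map_mul, ← map_mul]
        exact hf _ _ (.e_comm i j)
      | coe z =>
        obtain ⟨w, rfl⟩ := hφ.1 z
        rw [hD0, hD]
        exact hex i j hij w
    | coe y =>
      obtain ⟨w, rfl⟩ := hφ.1 y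
      induction z with
      | zero =>
        rw [hD0, hD]
        exact (hex j i hij.symm w).symm
      | coe z =>
        obtain ⟨w', rfl⟩ := hφ.1 z
        rw [hD, hD]
        exact hxx i j hij w w'
  refine ⟨MonoidHom.noncommPiCoprod D hcomm, fun i => ?_, fun i w => ?_⟩
  · rw [MonoidHom.noncommPiCoprod_mulSingle, hD0]
  · rw [MonoidHom.noncommPiCoprod_mulSingle, hD]

theorem permHom_mul_tupleHom {S : Equiv.Perm (Fin n) →* Q} {T : (Fin n → WithZero M) →* Q}
    (h : ∀ σ i (z : WithZero M),
      S σ * T (Pi.mulSingle i z) = T (Pi.mulSingle (σ i) z) * S σ)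
    (σ : Equiv.Perm (Fin n)) (a : Fin n → WithZero M) :
    S σ * T a = T (fun i => a (σ⁻¹ i)) * S σ := by
  let H : Submonoid (Fin n → WithZero M) :=
    { carrier := {b | S σ * T b = T (fun i => b (σ⁻¹ i)) * S σ}
      one_mem' := by
        change S σ * T 1 = T 1 * S σ
        simp
      mul_mem' := fun {b c} (hb : _ = _) (hc : _ = _) => by
        change S σ * T (b * c) = T ((fun i => b (σ⁻¹ i)) * fun i => c (σ⁻¹ i)) * S σ
        rw [map_mul, map_mul, ← mul_assoc, hb, mul_assoc, hc, mul_assoc] }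
  refine Submonoid.pi_mem_of_mulSingle_mem (H := H) a fun j => ?_
  change S σ * T _ = T _ * S σ
  rw [h, mulSingle_inv_apply]

/-- The relation `e_i e_{i+1} s_i = e_i e_{i+1}`, conjugated by a permutation which sends two given
points to `0` and `1`. -/
theorem tupleHom_mul_permHom_swap (hf : ∀ u w, WreathRel R n u w → f u = f w)
    {S : Equiv.Perm (Fin n) →* Q} {T : (Fin n → WithZero M) →* Q}
    (hS : ∀ (i : ℕ) (hi : i + 1 < n),
      S (Equiv.swap ⟨i, Nat.lt_of_succ_lt hi⟩ ⟨i + 1, hi⟩) = f (sw i hi))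
    (hT : ∀ i, T (Pi.mulSingle i 0) = f (ew i))
    (hST : ∀ σ i, S σ * f (ew i) = f (ew (σ i)) * S σ)
    {x y : Fin n} (hxy : x ≠ y) {a : Fin n → WithZero M} (hx : a x = 0) (hy : a y = 0) :
    T a * S (Equiv.swap x y) = T a := by
  have hn : 0 + 1 < n := by
    have := Fin.val_ne_of_ne hxy
    omega
  obtain ⟨σ, hσx, hσy⟩ : ∃ σ : Equiv.Perm (Fin n),
      σ ⟨0, Nat.lt_of_succ_lt hn⟩ = x ∧ σ ⟨0 + 1, hn⟩ = y := by
    set p : Fin n := ⟨0, Nat.lt_of_succ_lt hn⟩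
    set q : Fin n := ⟨0 + 1, hn⟩
    have hpq : p ≠ q := fun h => absurd (congrArg Fin.val h) (by simp [p, q])
    refine ⟨Equiv.swap (Equiv.swap p x q) y * Equiv.swap p x, ?_, ?_⟩
    · rw [Equiv.Perm.mul_apply, Equiv.swap_apply_left]
      refine Equiv.swap_apply_of_ne_of_ne (fun h => hpq ?_) hxy
      exact (Equiv.swap p x).injective ((Equiv.swap_apply_left p x).trans h)
    · rw [Equiv.Perm.mul_apply, Equiv.swap_apply_left]
  have hswap : f (ew x) * f (ew y) * S (Equiv.swap x y) = f (ew x) * f (ew y) := by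
    have hrel := hf _ _ (.e_e_s 0 hn)
    rw [map_mul, map_mul, ← hS 0 hn] at hrel
    have hconj : S σ * (f (ew ⟨0, Nat.lt_of_succ_lt hn⟩) * f (ew ⟨0 + 1, hn⟩)) =
        f (ew x) * f (ew y) * S σ := by
      rw [← mul_assoc, hST, mul_assoc, hST, ← mul_assoc, hσx, hσy]
    have hσ : Equiv.swap x y * σ =
        σ * Equiv.swap ⟨0, Nat.lt_of_succ_lt hn⟩ ⟨0 + 1, hn⟩ := by
      rw [Equiv.mul_swap_eq_swap_mul, hσx, hσy]
    have hinv : S σ * S σ⁻¹ = 1 := by rw [← map_mul, mul_inv_cancel, map_one]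
    calc f (ew x) * f (ew y) * S (Equiv.swap x y)
        = f (ew x) * f (ew y) * S (Equiv.swap x y * σ) * S σ⁻¹ := by
          rw [map_mul, ← mul_assoc, mul_assoc _ (S σ), hinv, mul_one]
      _ = f (ew x) * f (ew y) := by
          rw [hσ, map_mul, ← mul_assoc, ← hconj, mul_assoc (S σ), hrel, hconj, mul_assoc, hinv,
            mul_one]
  have ha : a = a * (Pi.mulSingle x 0 * Pi.mulSingle y 0) := by
    funext i
    by_cases h : i = x
    · simp [h, hx]
    · by_cases h' : i = y
      · simp [h', hy]
      · simp [h, h']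
  rw [ha, map_mul, map_mul, hT, hT, mul_assoc, hswap]

/-- In a normal form `T a * S σ`, only the restriction of `σ⁻¹` to the support of `a` matters. This
lemma is the case of the identity on the support: the permutation is then a product of
transpositions of points outside the support. -/
theorem tupleHom_mul_permHom {S : Equiv.Perm (Fin n) →* Q} {T : (Fin n → WithZero M) →* Q}
    (hTS : ∀ (a : Fin n → WithZero M) (x y : Fin n), x ≠ y → a x = 0 → a y = 0 →
      T a * S (Equiv.swap x y) = T a)
    {a : Fin n → WithZero M} {π : Equiv.Perm (Fin n)} (hπ : ∀ i, a i ≠ 0 → π i = i) :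
    T a * S π = T a := by
  classical
  have hmem : ∀ i, a (π i) = 0 ↔ a i = 0 := fun i => by
    constructor <;> intro h <;> by_contra h'
    · exact h' (by rwa [hπ i h'] at h)
    · exact h' (by rw [π.injective (hπ _ h'), h])
  have hsub : ∀ ρ : Equiv.Perm {i // a i = 0}, T a * S (Equiv.Perm.ofSubtype ρ) = T a := by
    intro ρ
    induction ρ using Equiv.Perm.swap_induction_on with
    | one => simp
    | swap_mul ρ x y hxy ih =>
      rw [map_mul, map_mul, ← mul_assoc, Equiv.Perm.ofSubtype_swap_eq,
        hTS a x y (fun h => hxy (Subtype.ext h)) x.2 y.2, ih]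
  rw [← Equiv.Perm.ofSubtype_subtypePerm hmem fun i hi => not_not.1 (mt (hπ i) hi)]
  exact hsub _

/-- A homomorphism from the free monoid which respects the defining relations identifies any two
words with the same value in the wreath product. -/
theorem map_eq_of_wreathHom_eq (hφ : HasMonoidPresentation R φ)
    (hf : ∀ u w, WreathRel R n u w → f u = f w) {u w : FreeMonoid (WreathGen X n)}
    (huw : wreathHom φ n u = wreathHom φ n w) : f u = f w := by
  obtain ⟨S, hS⟩ := exists_permHom_of_wreathRel hf
  obtain ⟨T, hT0, hT⟩ := exists_tupleHom_of_wreathRel hφ hf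
  have hSe : ∀ σ i, S σ * f (ew i) = f (ew (σ i)) * S σ :=
    permHom_mul_eq hf hS (y := fun i => f (ew i))
      (fun i hi j hj hj' => by
        rw [← map_mul, ← map_mul]
        exact hf _ _ (.s_e_comm i hi j hj hj'))
      (fun i hi => by
        rw [← map_mul, ← map_mul]
        exact hf _ _ (.s_e i hi))
  have hSx : ∀ a σ i, S σ * f (xw i a) = f (xw (σ i) a) * S σ := fun a =>
    permHom_mul_eq hf hS (y := fun i => f (xw i a))
      (fun i hi j hj hj' => by
        rw [← map_mul, ← map_mul]
        exact hf _ _ (.s_x_comm i hi j hj hj' a))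
      (fun i hi => by
        rw [← map_mul, ← map_mul]
        exact hf _ _ (.s_x i hi a))
  have hScopy : ∀ v σ i, S σ * f (copy i v) = f (copy (σ i) v) * S σ := fun v σ i => by
    induction v using FreeMonoid.recOn with
    | one => simp
    | of_mul a v ih =>
      have : S σ * f (copy i (FreeMonoid.of a)) = f (copy (σ i) (FreeMonoid.of a)) * S σ :=
        hSx a σ i
      rw [map_mul, map_mul, ← mul_assoc, this, mul_assoc, ih, map_mul, map_mul, mul_assoc]
  have hSsingle : ∀ σ i (z : WithZero M),
      S σ * T (Pi.mulSingle i z) = T (Pi.mulSingle (σ i) z) * S σ := fun σ i z => by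
    induction z with
    | zero => rw [hT0, hT0, hSe]
    | coe m =>
      obtain ⟨v, rfl⟩ := hφ.1 m
      rw [hT, hT, hScopy]
  -- Every word has a normal form, found by multiplying letters from the left.
  have hnf : ∀ v, ∃ a σ, f v = T a * S σ ∧ wreathHom φ n v = diag a * perm σ := by
    have hdiag : ∀ i z a σ, T (Pi.mulSingle i z) * (T a * S σ) = T (Pi.mulSingle i z * a) * S σ ∧
        (diag (Pi.mulSingle i z) * (diag a * perm σ) : WreathSymInv M n) =
          diag (Pi.mulSingle i z * a) * perm σ := fun i z a σ => by
      rw [map_mul, map_mul, mul_assoc, mul_assoc]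
      exact ⟨rfl, rfl⟩
    intro v
    induction v using FreeMonoid.recOn with
    | one => exact ⟨1, 1, by simp, by simp⟩
    | of_mul l v ih =>
      obtain ⟨a, σ, hfv, hwv⟩ := ih
      rw [map_mul, map_mul, hfv, hwv]
      cases l with
      | s i hi =>
        refine ⟨fun j => a ((Equiv.swap ⟨i, Nat.lt_of_succ_lt hi⟩ ⟨i + 1, hi⟩)⁻¹ j),
          Equiv.swap ⟨i, Nat.lt_of_succ_lt hi⟩ ⟨i + 1, hi⟩ * σ, ?_, ?_⟩
        · change f (sw i hi) * _ = _
          rw [← hS, ← mul_assoc, permHom_mul_tupleHom hSsingle, mul_assoc, ← map_mul S]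
        · change wreathHom φ n (sw i hi) * _ = _
          rw [wreathHom_sw, ← mul_assoc, perm_mul_diag, mul_assoc, ← map_mul perm]
      | e i =>
        refine ⟨_, _, ?_, (congrArg (· * _) (wreathHom_ew φ i)).trans (hdiag i 0 a σ).2⟩
        exact (congrArg (· * _) (hT0 i).symm).trans (hdiag i 0 a σ).1
      | x i y =>
        refine ⟨_, _, ?_, (congrArg (· * _) (wreathHom_xw φ i y)).trans (hdiag i _ a σ).2⟩
        exact (congrArg (· * _) (hT i (FreeMonoid.of y)).symm).trans (hdiag i _ a σ).1
  obtain ⟨a, σ, hfu, hu⟩ := hnf u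
  obtain ⟨b, τ, hfw, hw⟩ := hnf w
  rw [hu, hw] at huw
  obtain rfl : a = b := by rw [← diag_mul_perm_tuple a σ, huw, diag_mul_perm_tuple]
  have hστ : ∀ i, a i ≠ 0 → (σ * τ⁻¹) i = i := fun i hi => by
    have h := diag_mul_perm_map a σ i
    rw [huw, diag_mul_perm_map, if_neg hi, if_neg hi, Option.some_inj] at h
    rw [Equiv.Perm.mul_apply, h, ← Equiv.Perm.mul_apply, mul_inv_cancel, Equiv.Perm.one_apply]
  have habs := tupleHom_mul_permHom (S := S) (T := T)
    (fun a x y hxy hx hy => tupleHom_mul_permHom_swap hf hS hT0 hSe hxy hx hy) hστ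
  calc f u = T a * S (σ * τ⁻¹ * τ) := by rw [hfu, inv_mul_cancel_right]
    _ = f w := by rw [map_mul, ← mul_assoc, habs, hfw]

end

theorem mainTheorem1 {X : Type u} {M : Type v} [Monoid M]
    (R : FreeMonoid X → FreeMonoid X → Prop) (φ : FreeMonoid X →* M)
    (hφ : HasMonoidPresentation R φ) (n : ℕ) :
    HasMonoidPresentation (WreathRel R n) (wreathHom φ n) := by
  refine ⟨wreathHom_surjective φ hφ.1, le_antisymm (fun u w huw => ?_) ?_⟩
  · refine (Con.eq _).1 (map_eq_of_wreathHom_eq (f := (conGen (WreathRel R n)).mk') hφ ?_ huw)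
    exact fun u w h => (Con.eq _).2 (.of u w h)
  · refine Con.conGen_le.2 fun u w h => wreathHom_eq_of_rel φ (fun p q hpq => ?_) h
    have : Con.ker φ p q := hφ.2 ▸ ConGen.Rel.of p q hpq
    exact this
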